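/- Let $K=\mathbb{Q}(q)$ and let $O_q(M(n))$ be the associative unital $K$-algebra with generators $Z_{ij}$ ($1\le i,j\le n$) and defining relations $$Z_{ij}Z_{ik}=q^2Z_{ik}Z_{ij}\ (j<k),\qquad Z_{ij}Z_{kj}=q^2Z_{kj}Z_{ij}\ (i<k),$$ $$Z_{ij}Z_{st}=Z_{st}Z_{ij}\ (i>s,\ j<t),\qquad Z_{ij}Z_{st}=Z_{st}Z_{ij}+(q^2-q^{-2})Z_{it}Z_{sj}\ (i<s,\ j<t).$$ Let $x\mapsto\overline{x}$ be the ring anti-automorphism of $O_q(M(n))$ with $\overline{Z_{ij}}=Z_{ij}$ and $\overline{q}=q^{-1}$. For an $n\times n$ matrix $A=(a_{ij})$ of non-negative integers put $Z^A=\prod_{i,j}Z_{ij}^{a_{ij}}$, the factors being in the lexicographic order of the pairs $(i,j)$, and $$Z(A)=q^{-\sum_i\sum_{j>k}a_{ij}a_{ik}-\sum_i\sum_{j>k}a_{ji}a_{ki}}\,Z^A .$$ Let $L^*$ be the $\mathbb{Z}[q]$-span of all $Z(A)$. The dual canonical basis $B^*=\{b(A)\}$ is the $\mathbb{Z}[q]$-basis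 of $L^*$, indexed by the $n\times n$ matrices $A$ of non-negative integers, whose elements are determined by the conditions (1) $\overline{b(A)}=b(A)$; (2) $b(A)=Z(A)+\sum_{B<A}h_B(A)Z(B)$, a finite sum with $h_B(A)\in q\mathbb{Z}[q]$, over matrices $B$ which have the same row sums and the same column sums as $A$ and precede $A$ in the lexicographic order (entries read row by row). The quantum determinant is $$\det\nolimits_q=\sum_{\sigma\in S_n}(-q^2)^{l(\sigma)}Z_{1\sigma(1)}Z_{2\sigma(2)}\cdots Z_{n\sigma(n)},$$ where $l(\sigma)$ is the number of inversions of $\sigma$. For subsets $I=\{i_1<\dots<i_m\}$ and $J=\{j_1<\dots<j_m\}$ of $\{1,\dots,n\}$, the quantum minor $\det_q(I,J)$ is the image of the quantum determinant of $O_q(M(m))$ under the algebra homomorphism $O_q(M(m))\to O_q(M(n))$, $Z_{rs}\mapsto Z_{i_rj_s}$. **Lemma 3.3.** The quantum determinant $\det_q$ is an element of the basis $B^*$. More generally, every quantum minor $\det_q(I,J)$ is an element of $B^*$. That is, $\det_q$ and every $\det_q(I,J)$ satisfy conditions (1) and (2), in place of $b(A)$, for some matrix $A$; and for every $\mathbb{Z}[q]$-basis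 $(b(A))_A$ of $L^*$ satisfying (1) and (2) for all $A$, each of them equals $b(A)$ for some $A$. -/

import Mathlib

namespace QMat

noncomputable section

/-- The base field `ℚ(q)`. -/
abbrev K : Type := RatFunc ℚ

/-- The indeterminate `q`. -/
def q : K := RatFunc.X

theorem q_ne_zero : q ≠ 0 := RatFunc.X_ne_zero

/-- Evaluation of polynomials with rational coefficients at `q⁻¹`. -/
def evalInv : Polynomial ℚ →+* K := Polynomial.eval₂RingHom RatFunc.C q⁻¹

theorem evalInv_injective : Function.Injective evalInv := by
  rw [injective_iff_map_eq_zero]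
  intro p hp
  let _ : Invertible (q⁻¹ : K) := invertibleOfNonzero (inv_ne_zero q_ne_zero)
  have h := (Polynomial.eval₂_reverse_eq_zero_iff (RatFunc.C (K := ℚ)) q⁻¹ p).mpr hp
  rw [invOf_eq_inv, inv_inv] at h
  have h' : algebraMap (Polynomial ℚ) K p.reverse = Polynomial.eval₂ RatFunc.C q p.reverse := by
    have := Polynomial.hom_eval₂ p.reverse Polynomial.C (algebraMap (Polynomial ℚ) K) Polynomial.X
    rw [Polynomial.eval₂_C_X, RatFunc.algebraMap_X] at this
    rw [this]
    congr 1
  rw [h] at h'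
  exact Polynomial.reverse_eq_zero.mp
    ((map_eq_zero_iff _ (RatFunc.algebraMap_injective ℚ)).mp h')

/-- The ring endomorphism of `ℚ(q)` sending `q` to `q⁻¹`. -/
def barK : K →+* K :=
  RatFunc.liftRingHom evalInv
    (nonZeroDivisors_le_comap_nonZeroDivisors_of_injective _ evalInv_injective)

theorem barK_q : barK q = q⁻¹ := by
  have h : barK (algebraMap (Polynomial ℚ) K Polynomial.X) = evalInv Polynomial.X :=
    RatFunc.liftRingHom_algebraMap _ _ _
  rw [RatFunc.algebraMap_X] at h
  simpa [evalInv, q] using h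

/-- The free algebra on symbols indexed by `{1, …, n} × {1, …, n}`. -/
abbrev Free (n : ℕ) : Type := FreeAlgebra K (Fin n × Fin n)

/-- The free generator with index `(i, j)`. -/
abbrev gen {n : ℕ} (i j : Fin n) : Free n := FreeAlgebra.ι K (i, j)

/-- The defining relations of the algebra of `n × n` quantum matrices. -/
inductive Rel (n : ℕ) : Free n → Free n → Prop
  | row (i j k : Fin n) (h : j < k) :
      Rel n (gen i j * gen i k) (q ^ 2 • (gen i k * gen i j))
  | col (i k j : Fin n) (h : i < k) :
      Rel n (gen i j * gen k j) (q ^ 2 • (gen k j * gen i j))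
  | anti (i j s t : Fin n) (h₁ : s < i) (h₂ : j < t) :
      Rel n (gen i j * gen s t) (gen s t * gen i j)
  | diag (i j s t : Fin n) (h₁ : i < s) (h₂ : j < t) :
      Rel n (gen i j * gen s t)
        (gen s t * gen i j + (q ^ 2 - (q ^ 2)⁻¹) • (gen i t * gen s j))

/-- The coordinate algebra `O_q(M(n))` of quantum matrices. -/
def Oq (n : ℕ) : Type := RingQuot (Rel n)

instance (n : ℕ) : Ring (Oq n) := inferInstanceAs (Ring (RingQuot (Rel n)))

instance (n : ℕ) : Algebra K (Oq n) := inferInstanceAs (Algebra K (RingQuot (Rel n)))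

/-- The generators `Z i j` of `O_q(M(n))`. -/
def Z {n : ℕ} (i j : Fin n) : Oq n := RingQuot.mkAlgHom K (Rel n) (gen i j)

theorem Z_row {n : ℕ} (i j k : Fin n) (h : j < k) :
    Z i j * Z i k = q ^ 2 • (Z i k * Z i j : Oq n) := by
  have := RingQuot.mkAlgHom_rel K (Rel.row i j k h)
  rwa [map_smul, map_mul, map_mul] at this

theorem Z_col {n : ℕ} (i k j : Fin n) (h : i < k) :
    Z i j * Z k j = q ^ 2 • (Z k j * Z i j : Oq n) := by
  have := RingQuot.mkAlgHom_rel K (Rel.col i k j h)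
  rwa [map_smul, map_mul, map_mul] at this

theorem Z_anti {n : ℕ} (i j s t : Fin n) (h₁ : s < i) (h₂ : j < t) :
    Z i j * Z s t = (Z s t * Z i j : Oq n) := by
  have := RingQuot.mkAlgHom_rel K (Rel.anti i j s t h₁ h₂)
  rwa [map_mul, map_mul] at this

theorem Z_diag {n : ℕ} (i j s t : Fin n) (h₁ : i < s) (h₂ : j < t) :
    Z i j * Z s t = (Z s t * Z i j + (q ^ 2 - (q ^ 2)⁻¹) • (Z i t * Z s j) : Oq n) := by
  have := RingQuot.mkAlgHom_rel K (Rel.diag i j s t h₁ h₂)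
  rwa [map_add, map_smul, map_mul, map_mul, map_mul] at this

/-- The universal property of `O_q(M(n))`, for ring homomorphisms that need not be `K`-linear:
a ring homomorphism `f` from `K` to the centre of `R`, and elements `g i j` of `R` satisfying the
images of the defining relations under `f`, determine a ring homomorphism `O_q(M(n)) → R`. -/
def liftRing {n : ℕ} {R : Type} [Ring R] (f : K →+* R) (hf : ∀ c x, f c * x = x * f c)
    (g : Fin n → Fin n → R)
    (h_row : ∀ i j k, j < k → g i j * g i k = f (q ^ 2) * (g i k * g i j))
    (h_col : ∀ i k j, i < k → g i j * g k j = f (q ^ 2) * (g k j * g i j))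
    (h_anti : ∀ i j s t, s < i → j < t → g i j * g s t = g s t * g i j)
    (h_diag : ∀ i j s t, i < s → j < t →
      g i j * g s t = g s t * g i j + f (q ^ 2 - (q ^ 2)⁻¹) * (g i t * g s j)) :
    Oq n →+* R :=
  letI : Algebra K R := f.toAlgebra' hf
  (RingQuot.liftAlgHom K (s := Rel n)
    ⟨FreeAlgebra.lift K fun p : Fin n × Fin n => g p.1 p.2, by
      intro x y hxy
      have hs : ∀ (c : K) (r : R), c • r = f c * r := fun c r => Algebra.smul_def c r
      cases hxy with
      | row i j k h => simpa [hs] using h_row i j k h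
      | col i k j h => simpa [hs] using h_col i k j h
      | anti i j s t h₁ h₂ => simpa using h_anti i j s t h₁ h₂
      | diag i j s t h₁ h₂ =>
        simpa [hs, -map_sub, -map_pow, -map_inv₀] using h_diag i j s t h₁ h₂⟩).toRingHom

theorem liftRing_Z {n : ℕ} {R : Type} [Ring R] (f : K →+* R) (hf) (g : Fin n → Fin n → R)
    (h₁) (h₂) (h₃) (h₄) (i j : Fin n) : liftRing f hf g h₁ h₂ h₃ h₄ (Z i j) = g i j := by
  let _ : Algebra K R := f.toAlgebra' hf
  change RingQuot.liftAlgHom K _ (RingQuot.mkAlgHom K (Rel n) (gen i j)) = _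
  rw [RingQuot.liftAlgHom_mkAlgHom_apply]
  simp

theorem liftRing_algebraMap {n : ℕ} {R : Type} [Ring R] (f : K →+* R) (hf)
    (g : Fin n → Fin n → R) (h₁) (h₂) (h₃) (h₄) (c : K) :
    liftRing f hf g h₁ h₂ h₃ h₄ (algebraMap K (Oq n) c) = f c := by
  let _ : Algebra K R := f.toAlgebra' hf
  exact (RingQuot.liftAlgHom K (s := Rel n) _).commutes c

/-- The ring homomorphism `c ↦ c̄` from `K` to the opposite ring of `O_q(M(n))`. -/
def barScalar (n : ℕ) : K →+* (Oq n)ᵐᵒᵖ :=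
  ((algebraMap K (Oq n)).comp barK).toOpposite fun c _ => Algebra.commutes (barK c) _

theorem barScalar_mul {n : ℕ} (c : K) (x : Oq n) :
    barScalar n c * MulOpposite.op x = MulOpposite.op (barK c • x) := by
  change MulOpposite.op (x * algebraMap K (Oq n) (barK c)) = _
  rw [← Algebra.commutes, ← Algebra.smul_def]

theorem barScalar_comm {n : ℕ} (c : K) (x : (Oq n)ᵐᵒᵖ) :
    barScalar n c * x = x * barScalar n c :=
  congrArg MulOpposite.op (Algebra.commutes (barK c) x.unop).symm

theorem barK_q_sq : barK (q ^ 2) = (q ^ 2)⁻¹ := by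
  rw [map_pow, barK_q, inv_pow]

open MulOpposite in
/-- The bar anti-automorphism, as a ring homomorphism to the opposite ring. -/
def barOp (n : ℕ) : Oq n →+* (Oq n)ᵐᵒᵖ :=
  liftRing (barScalar n) barScalar_comm (fun i j => op (Z i j))
    (by
      intro i j k h
      rw [← op_mul, ← op_mul, barScalar_mul, barK_q_sq, Z_row i j k h, smul_smul,
        inv_mul_cancel₀ (pow_ne_zero 2 q_ne_zero), one_smul])
    (by
      intro i k j h
      rw [← op_mul, ← op_mul, barScalar_mul, barK_q_sq, Z_col i k j h, smul_smul,
        inv_mul_cancel₀ (pow_ne_zero 2 q_ne_zero), one_smul])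
    (by
      intro i j s t h₁ h₂
      rw [← op_mul, ← op_mul, Z_anti i j s t h₁ h₂])
    (by
      intro i j s t h₁ h₂
      rw [← op_mul, ← op_mul, ← op_mul, barScalar_mul, map_sub, map_inv₀, barK_q_sq, inv_inv,
        Z_diag i j s t h₁ h₂, Z_anti s j i t h₁ h₂, ← op_add, add_assoc, ← add_smul,
        sub_add_sub_cancel, sub_self, zero_smul, add_zero])

/-- The bar map of `O_q(M(n))`: the anti-automorphism with `Z i j ↦ Z i j` and `q ↦ q⁻¹`. -/
def bar {n : ℕ} (x : Oq n) : Oq n := (barOp n x).unop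

theorem bar_Z {n : ℕ} (i j : Fin n) : bar (Z i j : Oq n) = Z i j := by
  simp only [bar, barOp, liftRing_Z, MulOpposite.unop_op]

theorem bar_add {n : ℕ} (x y : Oq n) : bar (x + y) = bar x + bar y := by
  simp [bar]

theorem bar_mul {n : ℕ} (x y : Oq n) : bar (x * y) = bar y * bar x := by
  simp [bar]

theorem bar_smul {n : ℕ} (c : K) (x : Oq n) : bar (c • x) = barK c • bar x := by
  rw [Algebra.smul_def, bar_mul, Algebra.smul_def, Algebra.commutes]
  congr 1
  simp only [bar, barOp, liftRing_algebraMap]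
  rfl

/-- The monomial `Z^A`: the product of the `Z i j ^ A i j`, in the lexicographic order of the
pairs `(i, j)`. -/
def mono {n : ℕ} (A : Matrix (Fin n) (Fin n) ℕ) : Oq n :=
  ((List.finRange n).map fun i => ((List.finRange n).map fun j => Z i j ^ A i j).prod).prod

/-- The integer `∑_i ∑_{j>k} a_{ij} a_{ik} + ∑_i ∑_{j>k} a_{ji} a_{ki}`. -/
def dExp {n : ℕ} (A : Matrix (Fin n) (Fin n) ℕ) : ℕ :=
  (∑ i, ∑ j, ∑ k, if k < j then A i j * A i k else 0) +
    ∑ i, ∑ j, ∑ k, if k < j then A j i * A k i else 0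

/-- The normalized monomial `Z(A) = D(A) Z^A`. -/
def nmono {n : ℕ} (A : Matrix (Fin n) (Fin n) ℕ) : Oq n := (q⁻¹ ^ dExp A) • mono A

/-- The strict lexicographic order on matrices, entries being read in the lexicographic order of
their positions `(i, j)`. -/
def LexLT {n : ℕ} (B A : Matrix (Fin n) (Fin n) ℕ) : Prop :=
  ∃ i j, B i j < A i j ∧ ∀ s t, s < i ∨ (s = i ∧ t < j) → B s t = A s t

/-- Equality of all row sums and all column sums. -/
def SameSums {n : ℕ} (B A : Matrix (Fin n) (Fin n) ℕ) : Prop :=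
  (∀ i, ∑ j, B i j = ∑ j, A i j) ∧ ∀ j, ∑ i, B i j = ∑ i, A i j

/-- The subring `ℤ[q]` of `ℚ(q)`. -/
def Zq : Subring K := Subring.closure {q}

/-- The `ℤ[q]`-lattice `L^*` spanned by the `Z(A)`. -/
def Lstar (n : ℕ) : Submodule Zq (Oq n) :=
  Submodule.span Zq (Set.range (nmono (n := n)))

/-- The two conditions which characterize the element `b(A)`: `x` is bar-invariant, and
`x = Z(A) + ∑_{B < A} h_B Z(B)`, where `h_B ∈ q ℤ[q]` and each `B` has the row sums and the column
sums of `A`. -/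
def IsCanonical {n : ℕ} (A : Matrix (Fin n) (Fin n) ℕ) (x : Oq n) : Prop :=
  bar x = x ∧
    ∃ h : Matrix (Fin n) (Fin n) ℕ →₀ K,
      (∀ B ∈ h.support, LexLT B A ∧ SameSums B A ∧ ∃ r ∈ Zq, h B = q * r) ∧
      x = nmono A + h.sum fun B c => c • nmono B

/-- The set `B^*` of all elements `b(A)`. -/
def Bstar (n : ℕ) : Set (Oq n) := {x | ∃ A, IsCanonical A x}

/-- A family `b` indexed by the matrices is the dual canonical basis if it is a `ℤ[q]`-basis of
`L^*` and each `b A` satisfies the two conditions. -/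
structure IsDualCanonicalBasis {n : ℕ} (b : Matrix (Fin n) (Fin n) ℕ → Oq n) : Prop where
  linearIndependent : LinearIndependent Zq b
  span_eq : Submodule.span Zq (Set.range b) = Lstar n
  isCanonical : ∀ A, IsCanonical A (b A)

/-- The length of a permutation: its number of inversions. -/
def len {n : ℕ} (σ : Equiv.Perm (Fin n)) : ℕ :=
  (Finset.univ.filter fun p : Fin n × Fin n => p.1 < p.2 ∧ σ p.2 < σ p.1).card

/-- The quantum determinant `∑_σ (-q²)^{l(σ)} Z_{1σ(1)} Z_{2σ(2)} ⋯ Z_{nσ(n)}`. -/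
def detq (n : ℕ) : Oq n :=
  ∑ σ : Equiv.Perm (Fin n),
    (-q ^ 2) ^ len σ • ((List.finRange n).map fun i => Z i (σ i)).prod

/-- For `i_1 < ⋯ < i_m` and `j_1 < ⋯ < j_m`, the algebra homomorphism `O_q(M(m)) → O_q(M(n))`
with `Z r s ↦ Z i_r j_s`. Its image is the subalgebra generated by the elements `Z i_r j_s`. -/
def sub {m n : ℕ} (I J : Fin m ↪o Fin n) : Oq m →+* Oq n :=
  liftRing (algebraMap K (Oq n)) Algebra.commutes (fun r s => Z (I r) (J s))
    (fun i j k h => by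
      rw [← Algebra.smul_def]; exact Z_row _ _ _ (J.strictMono h))
    (fun i k j h => by
      rw [← Algebra.smul_def]; exact Z_col _ _ _ (I.strictMono h))
    (fun i j s t h₁ h₂ => Z_anti _ _ _ _ (I.strictMono h₁) (J.strictMono h₂))
    (fun i j s t h₁ h₂ => by
      rw [← Algebra.smul_def]; exact Z_diag _ _ _ _ (I.strictMono h₁) (J.strictMono h₂))

/-- The quantum minor `det_q(I, J)` of two subsets `I`, `J` of `{1, …, n}` with `m` elements each:
the quantum determinant of the subalgebra generated by the `Z i j` with `i ∈ I`, `j ∈ J`. -/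
def minorq {m n : ℕ} (I J : Finset (Fin n)) (hI : I.card = m) (hJ : J.card = m) : Oq n :=
  sub (I.orderEmbOfFin hI) (J.orderEmbOfFin hJ) (detq m)

end

end QMat

namespace QMat

noncomputable section

/-! ### Lengths of permutations -/

/-! Take the rows of a quantum minor in an arbitrary order τ (`rowDet`). By the 2×2 relations,
exchanging two adjacent rows that are in increasing order multiplies the expression by -q², so the
order τ yields (-q²)^{l(τ)} times the minor (`rowDet_eq`). For the longest permutation w₀ the rows
are reversed. Bar reverses products too, and l(σ) + l(σw₀) = l(w₀), so the same expression is
(-q²)^{l(w₀)} times the bar of the minor. Comparison gives bar-invariance (`bar_rowDet`).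

Condition (2) is read off the defining sum: its monomials belong to partial permutation matrices,
whose normalizing exponent is 0. The identity gives the lexicographically largest one, and every
other term has coefficient (-q²)^l with l > 0 (`isCanonical_rowDet`).

For a given dual canonical basis b, a canonical x with matrix A differs from b(A) by a bar-invariant
combination of the b(B) with coefficients in qℤ[q]. Such coefficients are fixed by q ↦ q⁻¹, hence
zero (`eq_zero_of_bar_eq`). -/

theorem len_one (m : ℕ) : len (1 : Equiv.Perm (Fin m)) = 0 := by
  rw [len, Finset.card_eq_zero, Finset.filter_eq_empty_iff]
  rintro p - ⟨h, h'⟩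
  exact lt_asymm h h'

/-- The adjacent transposition s preserves the order of every pair of positions except (k, k+1).
Thus (x, y) ↦ (s x, s y) carries the inversions of σ to those of σs other than (k, k+1), which is
the new one. -/
theorem len_mul_swap {m : ℕ} (k : Fin m) (σ : Equiv.Perm (Fin (m + 1)))
    (h : σ k.castSucc < σ k.succ) :
    len (σ * Equiv.swap k.castSucc k.succ) = len σ + 1 := by
  set s := Equiv.swap k.castSucc k.succ with hs
  have s1 : s k.castSucc = k.succ := Equiv.swap_apply_left _ _
  have s2 : s k.succ = k.castSucc := Equiv.swap_apply_right _ _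
  have ss : ∀ x, s (s x) = x := fun x => Equiv.swap_apply_self _ _ x
  clear_value s
  have hlt : ∀ x y : Fin (m + 1), x < y → ¬ (x = k.castSucc ∧ y = k.succ) → s x < s y := by
    intro x y hxy hne
    simp only [hs, Equiv.swap_apply_def]
    simp only [Fin.ext_iff, Fin.lt_def, Fin.val_castSucc, Fin.val_succ] at *
    split_ifs <;> (try simp only [Fin.val_castSucc, Fin.val_succ] at *) <;> omega
  have key : (Finset.univ.filter fun p : Fin (m + 1) × Fin (m + 1) =>
        p.1 < p.2 ∧ σ (s p.2) < σ (s p.1)) =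
      insert (k.castSucc, k.succ) ((Finset.univ.filter fun p : Fin (m + 1) × Fin (m + 1) =>
        p.1 < p.2 ∧ σ p.2 < σ p.1).map (s.prodCongr s).toEmbedding) := by
    ext ⟨x, y⟩
    simp only [Finset.mem_filter, Finset.mem_univ, true_and, Finset.mem_insert, Finset.mem_map,
      Prod.exists, Equiv.coe_toEmbedding, Equiv.prodCongr_apply, Prod.map_apply, Prod.mk.injEq]
    constructor
    · rintro ⟨h1, h2⟩
      by_cases hxy : x = k.castSucc ∧ y = k.succ
      · exact Or.inl hxy
      · exact Or.inr ⟨s x, s y, ⟨hlt x y h1 hxy, h2⟩, ss x, ss y⟩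
    · rintro (⟨rfl, rfl⟩ | ⟨a, b, ⟨h1, h2⟩, rfl, rfl⟩)
      · rw [s1, s2]
        exact ⟨Fin.castSucc_lt_succ, h⟩
      · rw [ss, ss]
        refine ⟨hlt a b h1 ?_, h2⟩
        rintro ⟨rfl, rfl⟩
        exact lt_asymm h h2
  change Finset.card (Finset.univ.filter fun p : Fin (m + 1) × Fin (m + 1) =>
    p.1 < p.2 ∧ σ (s p.2) < σ (s p.1)) = _
  rw [key, Finset.card_insert_of_notMem, Finset.card_map, len]
  simp only [Finset.mem_map, Finset.mem_filter, Finset.mem_univ, true_and, Prod.exists,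
    Equiv.coe_toEmbedding, Equiv.prodCongr_apply, Prod.map_apply, Prod.mk.injEq]
  rintro ⟨a, b, ⟨h1, -⟩, ha, hb⟩
  have ha' : a = k.succ := by rw [← ss a, ha, s1]
  have hb' : b = k.castSucc := by rw [← ss b, hb, s2]
  subst ha' hb'
  exact lt_asymm h1 Fin.castSucc_lt_succ

/-- Reversing the positions turns inversions into non-inversions, and w₀ inverts every pair. -/
theorem len_add_len_mul_rev {m : ℕ} (σ : Equiv.Perm (Fin m)) :
    len σ + len (σ * Fin.revPerm) = len (Fin.revPerm : Equiv.Perm (Fin m)) := by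
  have h2 : len (σ * Fin.revPerm) = (Finset.univ.filter fun p : Fin m × Fin m =>
      p.1 < p.2 ∧ ¬ σ p.2 < σ p.1).card := by
    refine Finset.card_bij' (fun p _ => (p.2.rev, p.1.rev)) (fun p _ => (p.2.rev, p.1.rev))
      ?_ ?_ ?_ ?_
    · rintro ⟨x, y⟩ h
      simp only [Finset.mem_filter, Finset.mem_univ, true_and, Equiv.Perm.mul_apply,
        Fin.revPerm_apply, Fin.rev_lt_rev] at h ⊢
      exact ⟨h.1, h.2.not_gt⟩
    · rintro ⟨x, y⟩ h
      simp only [Finset.mem_filter, Finset.mem_univ, true_and, Equiv.Perm.mul_apply,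
        Fin.revPerm_apply, Fin.rev_lt_rev, Fin.rev_rev, not_lt] at h ⊢
      exact ⟨h.1, lt_of_le_of_ne h.2 fun e => h.1.ne (σ.injective e)⟩
    · simp
    · simp
  have h3 : len (Fin.revPerm : Equiv.Perm (Fin m)) =
      (Finset.univ.filter fun p : Fin m × Fin m => p.1 < p.2).card := by
    simp [len]
  rw [h2, h3, len, ← Finset.filter_filter, ← Finset.filter_filter,
    Finset.card_filter_add_card_filter_not]

theorem exists_descent {m : ℕ} (τ : Equiv.Perm (Fin (m + 1))) (h : τ ≠ 1) :
    ∃ k : Fin m, τ k.succ < τ k.castSucc := by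
  by_contra! hk
  have hmono : StrictMono τ := Fin.strictMono_iff_lt_succ.mpr fun k =>
    lt_of_le_of_ne (hk k) fun e => Fin.castSucc_lt_succ.ne (τ.injective e)
  apply h
  ext x
  -- A finite chain has only one order automorphism.
  have := Subsingleton.elim (hmono.orderIsoOfSurjective _ τ.surjective) (OrderIso.refl _)
  exact congrArg Fin.val (DFunLike.congr_fun this x)

theorem len_pos {m : ℕ} {σ : Equiv.Perm (Fin m)} (h : σ ≠ 1) : 0 < len σ := by
  cases m with
  | zero => exact absurd (Subsingleton.elim _ _) h
  | succ m =>
    obtain ⟨k, hk⟩ := exists_descent σ h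
    exact Finset.card_pos.mpr ⟨(k.castSucc, k.succ), by simpa using hk⟩

/-! ### Row permutations of quantum minors -/

/-- The quantum minor expression on the rows `I` and columns `J`, with the rows taken in the
order given by `τ`. -/
def rowDet {m n : ℕ} (I J : Fin m ↪o Fin n) (τ : Equiv.Perm (Fin m)) : Oq n :=
  ∑ σ : Equiv.Perm (Fin m),
    (-q ^ 2) ^ len σ • ((List.finRange m).map fun r => Z (I (τ r)) (J (σ r))).prod

/-- This is the 2×2 case of the row exchange. On the right, the correction term of `Z_diag`
contributes -q²(q² - q⁻²) = 1 - q⁴, and the q⁴ of the second summand leaves coefficient 1. -/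
theorem Z_swap_rows {n : ℕ} {a b c d : Fin n} (hab : a < b) (hcd : c < d) :
    (Z b c * Z a d + -q ^ 2 • (Z b d * Z a c) : Oq n) =
      -q ^ 2 • (Z a c * Z b d + -q ^ 2 • (Z a d * Z b c)) := by
  rw [Z_diag a c b d hab hcd, Z_anti b c a d hab hcd]
  have hq := q_ne_zero
  rw [smul_add, smul_add, smul_smul, smul_smul, add_assoc, ← add_smul, add_comm]
  nth_rw 1 [← one_smul K (Z a d * Z b c : Oq n)]
  congr 2
  field_simp
  ring

/-- Pairing σ with σs groups the terms of a minor that differ only in two adjacent factors, where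
the 2×2 identity applies. -/
theorem sum_perm_eq_sum_ascent {m : ℕ} {M : Type*} [AddCommMonoid M] (k : Fin m)
    (F : Equiv.Perm (Fin (m + 1)) → M) :
    ∑ σ, F σ = ∑ σ with σ k.castSucc < σ k.succ,
      (F σ + F (σ * Equiv.swap k.castSucc k.succ)) := by
  rw [Finset.sum_add_distrib, ← Finset.sum_filter_add_sum_filter_not Finset.univ
    (fun σ : Equiv.Perm (Fin (m + 1)) => σ k.castSucc < σ k.succ)]
  congr 1
  refine Finset.sum_bij' (fun σ _ => σ * Equiv.swap k.castSucc k.succ)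
    (fun σ _ => σ * Equiv.swap k.castSucc k.succ) ?_ ?_ ?_ ?_ ?_
  · intro σ h
    simp only [Finset.mem_filter, Finset.mem_univ, true_and, not_lt, Equiv.Perm.mul_apply,
      Equiv.swap_apply_left, Equiv.swap_apply_right] at h ⊢
    exact lt_of_le_of_ne h fun e => Fin.castSucc_lt_succ.ne' (σ.injective e)
  · intro σ h
    simp only [Finset.mem_filter, Finset.mem_univ, true_and, not_lt, Equiv.Perm.mul_apply,
      Equiv.swap_apply_left, Equiv.swap_apply_right] at h ⊢
    exact h.le
  · intro σ _
    simp [mul_assoc]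
  · intro σ _
    simp [mul_assoc]
  · intro σ _
    simp [mul_assoc]

theorem finRange_split {m : ℕ} (k : Fin m) :
    ∃ l₁ l₂, List.finRange (m + 1) = l₁ ++ k.castSucc :: k.succ :: l₂ := by
  refine ⟨(List.finRange (m + 1)).take k, (List.finRange (m + 1)).drop (k + 2), ?_⟩
  have h1 : (k : ℕ) < (List.finRange (m + 1)).length := by simp
  have h2 : (k : ℕ) + 1 < (List.finRange (m + 1)).length := by simp
  conv_lhs => rw [← List.take_append_drop k (List.finRange (m + 1)),
    List.drop_eq_getElem_cons h1, List.drop_eq_getElem_cons h2]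
  congr 1
  congr 1
  · simp [Fin.ext_iff]
  congr 1
  simp [Fin.ext_iff]

theorem rowDet_mul_swap {m n : ℕ} (I J : Fin (m + 1) ↪o Fin n) (τ : Equiv.Perm (Fin (m + 1)))
    (k : Fin m) (h : τ k.castSucc < τ k.succ) :
    rowDet I J (τ * Equiv.swap k.castSucc k.succ) = -q ^ 2 • rowDet I J τ := by
  obtain ⟨l₁, l₂, hl⟩ := finRange_split k
  have hnd := List.nodup_finRange (m + 1)
  rw [hl] at hnd
  set s := Equiv.swap k.castSucc k.succ with hs
  have s1 : s k.castSucc = k.succ := Equiv.swap_apply_left _ _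
  have s2 : s k.succ = k.castSucc := Equiv.swap_apply_right _ _
  have hfix : ∀ r, r ∈ l₁ ∨ r ∈ l₂ → s r = r := by
    intro r hr
    apply Equiv.swap_apply_of_ne_of_ne
    all_goals
      rintro rfl
      simp only [List.nodup_append, List.nodup_cons, List.mem_cons] at hnd
      grind
  have hprod : ∀ ρ σ : Equiv.Perm (Fin (m + 1)),
      ((List.finRange (m + 1)).map fun r => (Z (I (ρ r)) (J (σ r)) : Oq n)).prod =
      (l₁.map fun r => (Z (I (ρ r)) (J (σ r)) : Oq n)).prod *
      (Z (I (ρ k.castSucc)) (J (σ k.castSucc)) * Z (I (ρ k.succ)) (J (σ k.succ))) *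
      (l₂.map fun r => (Z (I (ρ r)) (J (σ r)) : Oq n)).prod := by
    intro ρ σ
    rw [hl]
    simp [mul_assoc]
  have hr1 : ∀ l, (l = l₁ ∨ l = l₂) → ∀ ρ σ : Equiv.Perm (Fin (m + 1)),
      (l.map fun r => (Z (I ((ρ * s) r)) (J (σ r)) : Oq n)) =
      (l.map fun r => (Z (I (ρ r)) (J (σ r)) : Oq n)) := by
    intro l hl ρ σ
    refine List.map_congr_left fun r hr => ?_
    rw [Equiv.Perm.mul_apply, hfix r (by rcases hl with rfl | rfl <;> simp [hr])]
  have hr2 : ∀ l, (l = l₁ ∨ l = l₂) → ∀ ρ σ : Equiv.Perm (Fin (m + 1)),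
      (l.map fun r => (Z (I (ρ r)) (J ((σ * s) r)) : Oq n)) =
      (l.map fun r => (Z (I (ρ r)) (J (σ r)) : Oq n)) := by
    intro l hl ρ σ
    refine List.map_congr_left fun r hr => ?_
    rw [Equiv.Perm.mul_apply, hfix r (by rcases hl with rfl | rfl <;> simp [hr])]
  rw [rowDet, rowDet, sum_perm_eq_sum_ascent k, sum_perm_eq_sum_ascent k, Finset.smul_sum]
  refine Finset.sum_congr rfl fun σ hσ => ?_
  have hσ' : σ k.castSucc < σ k.succ := by simpa using hσ
  have hZ := Z_swap_rows (I.strictMono h) (J.strictMono hσ')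
  rw [len_mul_swap k σ hσ', ← hs]
  simp only [hprod, hr1 l₁ (Or.inl rfl), hr1 l₂ (Or.inr rfl), hr2 l₁ (Or.inl rfl),
    hr2 l₂ (Or.inr rfl)]
  simp only [Equiv.Perm.mul_apply, s1, s2]
  set A := (l₁.map fun r => (Z (I (τ r)) (J (σ r)) : Oq n)).prod
  set B := (l₂.map fun r => (Z (I (τ r)) (J (σ r)) : Oq n)).prod
  -- The factors at other positions are common to all four terms, so the 2×2 identity is multiplied
  -- by them on both sides.
  have := congrArg (fun x => (-q ^ 2) ^ len σ • (A * x * B)) hZ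
  simp only [mul_add, add_mul, smul_add, mul_smul_comm, smul_mul_assoc, smul_smul] at this ⊢
  rw [pow_succ (-q ^ 2) (len σ)]
  convert this using 3
  all_goals ring

/-- Induction on the length: removing a descent of τ shortens it by one and accounts for one factor
-q². -/
theorem rowDet_eq {m n : ℕ} (I J : Fin m ↪o Fin n) (τ : Equiv.Perm (Fin m)) :
    rowDet I J τ = (-q ^ 2) ^ len τ • rowDet I J 1 := by
  cases m with
  | zero => rw [Subsingleton.elim τ 1, len_one, pow_zero, one_smul]
  | succ m =>
    induction hN : len τ using Nat.strong_induction_on generalizing τ with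
    | _ N ih =>
      by_cases h1 : τ = 1
      · rw [← hN, h1, len_one, pow_zero, one_smul]
      obtain ⟨k, hk⟩ := exists_descent τ h1
      set s := Equiv.swap k.castSucc k.succ with hs
      have hasc : (τ * s) k.castSucc < (τ * s) k.succ := by
        simpa [hs] using hk
      have hτ : τ * s * s = τ := by simp [hs, mul_assoc]
      have hlen := len_mul_swap k (τ * s) hasc
      have hdet := rowDet_mul_swap I J (τ * s) k hasc
      rw [← hs, hτ] at hlen hdet
      rw [hdet, ih (len (τ * s)) (by omega) (τ * s) rfl, smul_smul, ← pow_succ', ← hN, hlen]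

/-! ### Bar-invariance of quantum minors -/

theorem bar_one {n : ℕ} : bar (1 : Oq n) = 1 := by
  simp [bar]

theorem bar_sum {n : ℕ} {ι : Type*} (s : Finset ι) (f : ι → Oq n) :
    bar (∑ i ∈ s, f i) = ∑ i ∈ s, bar (f i) := by
  simp [bar]

theorem bar_list_prod {n : ℕ} {ι : Type*} (l : List ι) (f : ι → Oq n)
    (hf : ∀ i, bar (f i) = f i) : bar (l.map f).prod = (l.reverse.map f).prod := by
  induction l with
  | nil => simpa using bar_one
  | cons a l ih => simp [bar_mul, ih, hf]

theorem bar_rowDet {m n : ℕ} (I J : Fin m ↪o Fin n) : bar (rowDet I J 1) = rowDet I J 1 := by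
  have hne : (-q ^ 2 : K) ≠ 0 := neg_ne_zero.mpr (pow_ne_zero 2 q_ne_zero)
  have hrev : rowDet I J Fin.revPerm =
      (-q ^ 2) ^ len (Fin.revPerm : Equiv.Perm (Fin m)) • bar (rowDet I J 1) := by
    rw [rowDet, rowDet, bar_sum, Finset.smul_sum,
      -- Reindexing by σ ↦ σw₀ matches the two sums term by term.
      ← Equiv.sum_comp (Equiv.mulRight (Fin.revPerm : Equiv.Perm (Fin m)))]
    refine Finset.sum_congr rfl fun σ _ => ?_
    rw [bar_smul, bar_list_prod _ _ fun r => bar_Z _ _, smul_smul, List.finRange_reverse,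
      List.map_map, Equiv.coe_mulRight]
    congr 1
    rw [map_pow, map_neg, barK_q_sq, neg_inv, ← len_add_len_mul_rev σ, inv_pow, pow_add]
    field_simp
  rw [rowDet_eq] at hrev
  exact (smul_right_injective _ (pow_ne_zero _ hne) hrev).symm

/-! ### Expansion of quantum minors in monomials -/

/-- The partial permutation matrix with entry `1` at the positions `(I r, J (σ r))`. -/
def permMat {m n : ℕ} (I J : Fin m ↪o Fin n) (σ : Equiv.Perm (Fin m)) :
    Matrix (Fin n) (Fin n) ℕ :=
  fun i j => ∑ r, if I r = i ∧ J (σ r) = j then 1 else 0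

section permMat

variable {m n : ℕ} (I J : Fin m ↪o Fin n) (σ : Equiv.Perm (Fin m))

theorem permMat_apply (r : Fin m) (j : Fin n) :
    permMat I J σ (I r) j = if J (σ r) = j then 1 else 0 := by
  simp [permMat, ite_and]

theorem permMat_of_notMem (i j : Fin n) (hi : i ∉ Set.range I) : permMat I J σ i j = 0 :=
  Finset.sum_eq_zero fun r _ => if_neg fun h => hi ⟨r, h.1⟩

theorem permMat_ne_zero {i j : Fin n} (h : permMat I J σ i j ≠ 0) :
    ∃ r, I r = i ∧ J (σ r) = j := by
  obtain ⟨r, -, hr⟩ := Finset.exists_ne_zero_of_sum_ne_zero h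
  exact ⟨r, by simpa using hr⟩

/-- Each row and each column has at most one nonzero entry. -/
theorem dExp_permMat : dExp (permMat I J σ) = 0 := by
  have h1 : ∀ i j k, k < j → permMat I J σ i j * permMat I J σ i k = 0 := by
    intro i j k hkj
    by_contra h
    obtain ⟨r, hr, rfl⟩ := permMat_ne_zero I J σ (left_ne_zero_of_mul h)
    obtain ⟨r', hr', rfl⟩ := permMat_ne_zero I J σ (right_ne_zero_of_mul h)
    exact hkj.ne (by rw [I.injective (hr'.trans hr.symm)])
  have h2 : ∀ i j k, k < j → permMat I J σ j i * permMat I J σ k i = 0 := by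
    intro i j k hkj
    by_contra h
    obtain ⟨r, rfl, hr⟩ := permMat_ne_zero I J σ (left_ne_zero_of_mul h)
    obtain ⟨r', rfl, hr'⟩ := permMat_ne_zero I J σ (right_ne_zero_of_mul h)
    exact hkj.ne (by rw [σ.injective (J.injective (hr'.trans hr.symm))])
  rw [dExp, Nat.add_eq_zero_iff]
  constructor <;>
  · refine Finset.sum_eq_zero fun i _ => Finset.sum_eq_zero fun j _ =>
      Finset.sum_eq_zero fun k _ => ?_
    split_ifs with h
    · first | exact h1 i j k h | exact h2 i j k h
    · rfl

theorem list_prod_map_filter {ι M : Type*} [Monoid M] (l : List ι) (p : ι → Prop)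
    [DecidablePred p] (f : ι → M) (hf : ∀ i, ¬ p i → f i = 1) :
    ((l.filter p).map f).prod = (l.map f).prod := by
  induction l with
  | nil => rfl
  | cons a l ih =>
    by_cases h : p a
    · simp [h, ih]
    · simp [h, ih, hf a h]

open Classical in
-- The monoid is not commutative, so the lists themselves must agree once trivial factors are
-- dropped. They do: both are strictly increasing with the same elements.
theorem list_prod_map_finRange {M : Type*} [Monoid M] (e : Fin m ↪o Fin n) (f : Fin n → M)
    (hf : ∀ i, i ∉ Set.range e → f i = 1) :
    ((List.finRange n).map f).prod = ((List.finRange m).map fun r => f (e r)).prod := by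
  have h : (List.finRange n).filter (· ∈ Set.range e) = (List.finRange m).map e := by
    refine List.Perm.eq_of_pairwise (le := (· < ·)) ?_ ?_ ?_ ?_
    · intro a b _ _ h1 h2
      exact absurd h1 h2.not_gt
    · exact (List.pairwise_lt_finRange n).filter _
    · exact (List.pairwise_lt_finRange m).map _ fun a b h => e.strictMono h
    · rw [List.perm_ext_iff_of_nodup ((List.nodup_finRange n).filter _)
        ((List.nodup_finRange m).map e.injective)]
      simp
  rw [← list_prod_map_filter _ (· ∈ Set.range e) f hf, h, List.map_map]
  rfl

theorem nmono_permMat : nmono (permMat I J σ) =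
    ((List.finRange m).map fun r => (Z (I r) (J (σ r)) : Oq n)).prod := by
  rw [nmono, dExp_permMat, pow_zero, one_smul, mono, list_prod_map_finRange I]
  · congr 1
    refine List.map_congr_left fun r _ => ?_
    -- Within row `I r` only column `J (σ r)` contributes, so the product is restricted along an
    -- embedding of a one-point chain.
    rw [list_prod_map_finRange (OrderEmbedding.ofStrictMono (fun _ : Fin 1 => J (σ r))
      (Subsingleton.strictMono _))]
    · simp [permMat_apply]
    · intro j hj
      have : J (σ r) ≠ j := by simpa [eq_comm] using hj
      rw [permMat_apply, if_neg this, pow_zero]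
  · intro i hi
    simp [permMat_of_notMem I J σ i _ hi]

theorem sum_permMat_row (i : Fin n) :
    ∑ j, permMat I J σ i j = ∑ r, if I r = i then 1 else 0 := by
  simp only [permMat]
  rw [Finset.sum_comm]
  simp [ite_and]

theorem sum_permMat_col (j : Fin n) :
    ∑ i, permMat I J σ i j = ∑ r, if J r = j then 1 else 0 := by
  simp only [permMat]
  rw [Finset.sum_comm, ← Equiv.sum_comp σ fun r => if J r = j then 1 else 0]
  refine Finset.sum_congr rfl fun r _ => ?_
  simp only [ite_and, Finset.sum_ite_eq, Finset.mem_univ, if_true]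

theorem sameSums_permMat : SameSums (permMat I J σ) (permMat I J 1) :=
  ⟨fun i => by rw [sum_permMat_row, sum_permMat_row],
    fun j => by rw [sum_permMat_col, sum_permMat_col]⟩

/-- Let r be the first point moved by σ. All smaller values are already taken, so σ r > r, and the
first differing entry is at (I r, J r), where the identity has 1 and σ has 0. -/
theorem lexLT_permMat (h : σ ≠ 1) : LexLT (permMat I J σ) (permMat I J 1) := by
  have hex : ∃ r, σ r ≠ r := by
    by_contra! hc
    exact h (Equiv.ext hc)
  obtain ⟨r, hr, hmin⟩ := WellFounded.has_min (wellFounded_lt (α := Fin m)) {r | σ r ≠ r} hex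
  have hfix : ∀ s < r, σ s = s := fun s hs => by
    by_contra hc
    exact hmin s hc hs
  have hlt : r < σ r := by
    refine lt_of_le_of_ne (le_of_not_gt fun hlt => ?_) (Ne.symm hr)
    exact hr (σ.injective (hfix _ hlt))
  refine ⟨I r, J r, ?_, ?_⟩
  · have hr' : σ r ≠ r := hr
    simp [permMat_apply, hr']
  · rintro s t (hs | ⟨rfl, ht⟩)
    · by_cases hsI : s ∈ Set.range I
      · obtain ⟨s, rfl⟩ := hsI
        rw [permMat_apply, permMat_apply, hfix s (I.lt_iff_lt.mp hs), Equiv.Perm.one_apply]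
      · rw [permMat_of_notMem _ _ _ _ _ hsI, permMat_of_notMem _ _ _ _ _ hsI]
    · rw [permMat_apply, permMat_apply, if_neg, if_neg]
      · exact ht.ne'
      · exact (ht.trans (J.strictMono hlt)).ne'

end permMat

/-! ### Quantum minors satisfy the two conditions -/

theorem q_mem_Zq : q ∈ Zq := Subring.subset_closure rfl

theorem isCanonical_rowDet {m n : ℕ} (I J : Fin m ↪o Fin n) :
    IsCanonical (permMat I J 1) (rowDet I J 1) := by
  classical
  -- Writing the coefficients as a sum of singletons makes injectivity of σ ↦ `permMat I J σ`
  -- unnecessary: any coinciding terms add up inside qℤ[q].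
  refine ⟨bar_rowDet I J, ∑ σ ∈ Finset.univ.erase (1 : Equiv.Perm (Fin m)),
    Finsupp.single (permMat I J σ) ((-q ^ 2) ^ len σ), ?_, ?_⟩
  · intro B hB
    have hB' := hB
    rw [Finsupp.mem_support_iff, Finsupp.finsetSum_apply] at hB'
    obtain ⟨σ, hσ, hne⟩ := Finset.exists_ne_zero_of_sum_ne_zero hB'
    have hσB : permMat I J σ = B := by
      by_contra hc
      exact hne (Finsupp.single_eq_of_ne' hc)
    rw [← hσB]
    refine ⟨lexLT_permMat I J σ (Finset.ne_of_mem_erase hσ), sameSums_permMat I J σ, ?_⟩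
    rw [Finsupp.finsetSum_apply]
    refine Finset.sum_induction _ (fun c : K => ∃ r ∈ Zq, c = q * r) ?_
      ⟨0, Zq.zero_mem, (mul_zero q).symm⟩ ?_
    · rintro _ _ ⟨r, hr, rfl⟩ ⟨s, hs, rfl⟩
      exact ⟨r + s, Zq.add_mem hr hs, (mul_add _ _ _).symm⟩
    · intro ρ hρ
      obtain ⟨l, hl⟩ := Nat.exists_eq_add_of_lt (len_pos (Finset.ne_of_mem_erase hρ))
      rw [Finsupp.single_apply]
      split_ifs
      · refine ⟨-q * (-q ^ 2) ^ l, Zq.mul_mem (Zq.neg_mem q_mem_Zq)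
          (Zq.pow_mem (Zq.neg_mem (Zq.pow_mem q_mem_Zq 2)) l), ?_⟩
        rw [hl, zero_add, pow_succ]
        ring
      · exact ⟨0, Zq.zero_mem, (mul_zero q).symm⟩
  · change _ = _ + Finsupp.linearCombination K nmono _
    rw [map_sum, rowDet, ← Finset.add_sum_erase _ _ (Finset.mem_univ 1), len_one, pow_zero,
      one_smul, nmono_permMat]
    congr 1
    refine Finset.sum_congr rfl fun σ _ => ?_
    rw [Finsupp.linearCombination_single, nmono_permMat]
    rfl

theorem detq_eq_rowDet (n : ℕ) : detq n = rowDet (RelEmbedding.refl _) (RelEmbedding.refl _) 1 :=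
  rfl

theorem sub_smul {m n : ℕ} (I J : Fin m ↪o Fin n) (c : K) (x : Oq m) :
    sub I J (c • x) = c • sub I J x := by
  rw [Algebra.smul_def, map_mul, sub, liftRing_algebraMap, ← Algebra.smul_def]

theorem sub_detq {m n : ℕ} (I J : Fin m ↪o Fin n) : sub I J (detq m) = rowDet I J 1 := by
  rw [detq, map_sum]
  refine Finset.sum_congr rfl fun σ _ => ?_
  rw [sub_smul, map_list_prod, List.map_map]
  congr 3
  funext r
  exact liftRing_Z _ _ _ _ _ _ _ _ _

/-! ### Uniqueness of the dual canonical basis -/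

theorem mem_Zq_iff {r : K} :
    r ∈ Zq ↔ ∃ p : Polynomial ℤ, p.eval₂ (Int.castRingHom K) q = r := by
  constructor
  · intro hr
    have : Zq ≤ (Polynomial.eval₂RingHom (Int.castRingHom K) q).range :=
      Subring.closure_le.mpr (by
        rintro _ rfl
        exact ⟨Polynomial.X, Polynomial.eval₂_X _ _⟩)
    exact this hr
  · rintro ⟨p, rfl⟩
    rw [Polynomial.eval₂_eq_sum_range]
    exact Zq.sum_mem fun i _ => Zq.mul_mem (by simp) (Zq.pow_mem q_mem_Zq i)

/-- Since q is transcendental, elements of ℤ[q] can be compared as polynomials, with degrees. -/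
theorem eval₂_q_injective :
    Function.Injective fun p : Polynomial ℤ => p.eval₂ (Int.castRingHom K) q := by
  intro p p' h
  have key : ∀ p : Polynomial ℤ, p.eval₂ (Int.castRingHom K) q =
      algebraMap (Polynomial ℚ) K (p.map (Int.castRingHom ℚ)) := by
    intro p
    have h := Polynomial.hom_eval₂ (p.map (Int.castRingHom ℚ)) Polynomial.C
      (algebraMap (Polynomial ℚ) K) Polynomial.X
    rw [Polynomial.eval₂_C_X, RatFunc.algebraMap_X, Polynomial.eval₂_map] at h
    rw [h]
    congr 1
    exact Subsingleton.elim _ _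
  simp only [key] at h
  exact Polynomial.map_injective _ Int.cast_injective (RatFunc.algebraMap_injective ℚ h)

theorem barK_eval₂ (p : Polynomial ℤ) :
    barK (p.eval₂ (Int.castRingHom K) q) =
      p.reverse.eval₂ (Int.castRingHom K) q * q⁻¹ ^ p.natDegree := by
  let _ : Invertible (q⁻¹ : K) := invertibleOfNonzero (inv_ne_zero q_ne_zero)
  have h := Polynomial.eval₂_reverse_mul_pow (Int.castRingHom K) q⁻¹ p
  rw [invOf_eq_inv, inv_inv] at h
  rw [h, Polynomial.hom_eval₂, barK_q]
  congr 1
  exact Subsingleton.elim _ _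

/-- Bar leaves ℤ[q], while linear independence is assumed over ℤ[q] only, so negative powers of q
must be cleared. Allowing every larger exponent gives a common one for finitely many coefficients.
-/
theorem exists_pow_mul_barK_mem {r : K} (hr : r ∈ Zq) :
    ∃ N, ∀ M, N ≤ M → q ^ M * barK r ∈ Zq := by
  obtain ⟨p, rfl⟩ := mem_Zq_iff.mp hr
  refine ⟨p.natDegree, fun M hM => ?_⟩
  obtain ⟨d, rfl⟩ := Nat.exists_eq_add_of_le hM
  rw [barK_eval₂, inv_pow]
  have : q ^ (p.natDegree + d) *
      (p.reverse.eval₂ (Int.castRingHom K) q * (q ^ p.natDegree)⁻¹) =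
      q ^ d * p.reverse.eval₂ (Int.castRingHom K) q := by
    have := pow_ne_zero p.natDegree q_ne_zero
    rw [pow_add]
    field_simp
  rw [this]
  exact Zq.mul_mem (Zq.pow_mem q_mem_Zq d) (mem_Zq_iff.mpr ⟨_, rfl⟩)

/-- For r = p(q) with p ≠ 0 of degree d, invariance of q·p(q) reads X^{d+2}·p = `p.reverse`. The
left side has degree 2d + 2, the right at most d. -/
theorem eq_zero_of_barK_q_mul {r : K} (hr : r ∈ Zq) (h : barK (q * r) = q * r) : r = 0 := by
  obtain ⟨p, rfl⟩ := mem_Zq_iff.mp hr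
  by_contra hne
  have hp : p ≠ 0 := by
    rintro rfl
    exact hne (Polynomial.eval₂_zero _ _)
  have hq := q_ne_zero
  have heq : Polynomial.X ^ (p.natDegree + 2) * p = p.reverse := by
    apply eval₂_q_injective
    rw [map_mul, barK_q, barK_eval₂] at h
    simp only [Polynomial.eval₂_mul, Polynomial.eval₂_X_pow]
    have hq' := pow_ne_zero p.natDegree q_ne_zero
    rw [inv_pow] at h
    field_simp at h
    rw [h]
    ring
  have hdeg := congrArg Polynomial.natDegree heq
  rw [Polynomial.natDegree_X_pow_mul _ hp] at hdeg
  have := Polynomial.reverse_natDegree_le p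
  omega

/-! ### Triangularity and comparison with a given basis -/

theorem wellFounded_lexLT (n : ℕ) : WellFounded (LexLT (n := n)) := by
  have h : WellFounded (Pi.Lex (β := fun _ : Fin n => Fin n → ℕ) (· < ·)
      (fun {_} => Pi.Lex (β := fun _ : Fin n => ℕ) (· < ·) (fun {_} => (· < ·)))) :=
    Pi.Lex.wellFounded _ fun _ => Pi.Lex.wellFounded _ fun _ => wellFounded_lt
  refine Subrelation.wf ?_ h
  rintro B A ⟨i, j, hlt, heq⟩
  exact ⟨i, fun s hs => funext fun t => heq s t (Or.inl hs),
    j, fun t ht => heq i t (Or.inr ⟨rfl, ht⟩), hlt⟩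

theorem smul_mem_span_of_mem {n : ℕ} {S : Submodule Zq (Oq n)} {r : K} (hr : r ∈ Zq) {x : Oq n}
    (hx : x ∈ S) : r • x ∈ S :=
  S.smul_mem (⟨r, hr⟩ : Zq) hx

/-- A canonical element is congruent to its leading monomial modulo any `ℤ[q]`-submodule which
contains the multiples by `q` of the lower monomials. -/
theorem IsCanonical.sub_nmono_mem {n : ℕ} {A : Matrix (Fin n) (Fin n) ℕ} {x : Oq n}
    (hx : IsCanonical A x) (S : Submodule Zq (Oq n))
    (hS : ∀ B, LexLT B A → q • nmono B ∈ S) : x - nmono A ∈ S := by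
  obtain ⟨-, h, hh, rfl⟩ := hx
  rw [add_sub_cancel_left]
  refine S.sum_mem fun B hB => ?_
  obtain ⟨hlt, -, r, hr, hBr⟩ := hh B hB
  change h B • nmono B ∈ S
  rw [hBr, mul_comm, mul_smul]
  exact smul_mem_span_of_mem hr (hS B hlt)

section Basis

variable {n : ℕ} {b : Matrix (Fin n) (Fin n) ℕ → Oq n}

/-- Well-founded induction inverts the triangular system through q Z(B) = q b(B) - q (b(B) - Z(B)).
Linear independence of the monomials is not needed. -/
theorem sub_nmono_mem_span (hb : ∀ A, IsCanonical A (b A)) (A : Matrix (Fin n) (Fin n) ℕ) :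
    b A - nmono A ∈ Submodule.span Zq (Set.range fun B => q • b B) := by
  induction A using (wellFounded_lexLT n).induction with
  | _ A ih =>
    refine (hb A).sub_nmono_mem _ fun B hB => ?_
    have h : q • nmono B = q • b B - q • (b B - nmono B) := by
      rw [smul_sub, sub_sub_cancel]
    rw [h]
    exact Submodule.sub_mem _ (Submodule.subset_span ⟨B, rfl⟩)
      (smul_mem_span_of_mem q_mem_Zq (ih B hB))

theorem IsCanonical.sub_mem_span (hb : ∀ A, IsCanonical A (b A)) {A : Matrix (Fin n) (Fin n) ℕ}
    {x : Oq n} (hx : IsCanonical A x) :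
    x - b A ∈ Submodule.span Zq (Set.range fun B => q • b B) := by
  have h : x - b A = (x - nmono A) - (b A - nmono A) := by abel
  rw [h]
  refine Submodule.sub_mem _ (hx.sub_nmono_mem _ fun B _ => ?_) (sub_nmono_mem_span hb A)
  have h : q • nmono B = q • b B - q • (b B - nmono B) := by
    rw [smul_sub, sub_sub_cancel]
  rw [h]
  exact Submodule.sub_mem _ (Submodule.subset_span ⟨B, rfl⟩)
    (smul_mem_span_of_mem q_mem_Zq (sub_nmono_mem_span hb B))

/-- Applying bar replaces each coefficient q c(B) by its image under q ↦ q⁻¹. Subtracting and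
multiplying by a large power of q gives a relation over ℤ[q], so each coefficient is fixed and
therefore zero. -/
theorem eq_zero_of_bar_eq (hb : LinearIndependent Zq b) (hbar : ∀ A, bar (b A) = b A) {y : Oq n}
    (hy : bar y = y) (hmem : y ∈ Submodule.span Zq (Set.range fun B => q • b B)) : y = 0 := by
  obtain ⟨c, rfl⟩ := Finsupp.mem_span_range_iff_exists_finsupp.mp hmem
  have hsum : (c.sum fun B a => a • q • b B) = ∑ B ∈ c.support, (q * (c B : K)) • b B := by
    refine Finset.sum_congr rfl fun B _ => ?_
    rw [mul_comm, mul_smul]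
    rfl
  rw [hsum] at hy ⊢
  have hbound : ∀ B, ∃ N, ∀ M, N ≤ M → q ^ M * barK (q * (c B : K)) ∈ Zq := fun B =>
    exists_pow_mul_barK_mem (Zq.mul_mem q_mem_Zq (c B).2)
  choose N hN using hbound
  set M := c.support.sup N with hM
  have hmem' : ∀ B ∈ c.support, q ^ M * (q * (c B : K)) - q ^ M * barK (q * (c B : K)) ∈ Zq :=
    fun B hB => Zq.sub_mem
      (Zq.mul_mem (Zq.pow_mem q_mem_Zq M) (Zq.mul_mem q_mem_Zq (c B).2))
      (hN B M (Finset.le_sup hB))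
  -- The exponent M clears denominators only on the support of c; the value 0 elsewhere plays no
  -- role.
  let g : Matrix (Fin n) (Fin n) ℕ → Zq := fun B =>
    if hB : B ∈ c.support then ⟨_, hmem' B hB⟩ else 0
  have hg : ∑ B ∈ c.support, g B • b B = 0 := by
    have h1 : ∑ B ∈ c.support, g B • b B = q ^ M • (∑ B ∈ c.support, (q * (c B : K)) • b B) -
        q ^ M • bar (∑ B ∈ c.support, (q * (c B : K)) • b B) := by
      rw [bar_sum, Finset.smul_sum, Finset.smul_sum, ← Finset.sum_sub_distrib]
      refine Finset.sum_congr rfl fun B hB => ?_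
      rw [bar_smul, hbar, smul_smul, smul_smul, ← _root_.sub_smul]
      simp only [g, dif_pos hB]
      rfl
    rw [h1, hy, sub_self]
  refine Finset.sum_eq_zero fun B hB => ?_
  have h0 := linearIndependent_iff'.mp hb c.support g hg B hB
  have h1 : q ^ M * (q * (c B : K)) - q ^ M * barK (q * (c B : K)) = 0 := by
    have := congrArg Subtype.val h0
    simpa only [g, dif_pos hB, ZeroMemClass.coe_zero] using this
  have h2 := mul_left_cancel₀ (pow_ne_zero M q_ne_zero) (sub_eq_zero.mp h1)
  rw [eq_zero_of_barK_q_mul (c B).2 h2.symm, mul_zero, zero_smul]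

theorem IsDualCanonicalBasis.eq_of_isCanonical (hb : IsDualCanonicalBasis b)
    {A : Matrix (Fin n) (Fin n) ℕ} {x : Oq n} (hx : IsCanonical A x) : b A = x := by
  have hbar : bar (x - b A) = x - b A := by
    have h : ∀ y z : Oq n, bar (y - z) = bar y - bar z := fun y z => by simp [bar]
    rw [h, hx.1, (hb.isCanonical A).1]
  have := eq_zero_of_bar_eq hb.linearIndependent (fun B => (hb.isCanonical B).1) hbar
    (hx.sub_mem_span hb.isCanonical)
  exact (sub_eq_zero.mp this).symm

end Basis

end

end QMat

theorem lemma3p3 (n : ℕ) :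
    (QMat.detq n ∈ QMat.Bstar n ∧
      ∀ (m : ℕ) (I J : Finset (Fin n)) (hI : I.card = m) (hJ : J.card = m),
        QMat.minorq I J hI hJ ∈ QMat.Bstar n) ∧
    ∀ b : Matrix (Fin n) (Fin n) ℕ → QMat.Oq n, QMat.IsDualCanonicalBasis b →
      QMat.detq n ∈ Set.range b ∧
      ∀ (m : ℕ) (I J : Finset (Fin n)) (hI : I.card = m) (hJ : J.card = m),
        QMat.minorq I J hI hJ ∈ Set.range b := by
  have hdet : QMat.IsCanonical
      (QMat.permMat (RelEmbedding.refl (· ≤ ·)) (RelEmbedding.refl (· ≤ ·)) 1) (QMat.detq n) := by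
    rw [QMat.detq_eq_rowDet]
    exact QMat.isCanonical_rowDet _ _
  have hminor : ∀ (m : ℕ) (I J : Finset (Fin n)) (hI : I.card = m) (hJ : J.card = m),
      QMat.IsCanonical (QMat.permMat (I.orderEmbOfFin hI) (J.orderEmbOfFin hJ) 1)
        (QMat.minorq I J hI hJ) := fun m I J hI hJ => by
    rw [QMat.minorq, QMat.sub_detq]
    exact QMat.isCanonical_rowDet _ _
  exact ⟨⟨⟨_, hdet⟩, fun m I J hI hJ => ⟨_, hminor m I J hI hJ⟩⟩,
    fun b hb => ⟨⟨_, hb.eq_of_isCanonical hdet⟩,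
      fun m I J hI hJ => ⟨_, hb.eq_of_isCanonical (hminor m I J hI hJ)⟩⟩⟩
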